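/- **Proposition 4.6 (group $\mathbb{R}^2\rtimes\mathbb{R}^+$).** Let $G=\mathbb{R}^2\rtimes\mathbb{R}^+=\{(x,y,z)\in\mathbb{R}^3: z>0\}$ be the Lie group with multiplication $(x,y,z)\cdot(x',y',z')=(x+zx',\,y+zy',\,zz')$, and let $g$ be the left-invariant Riemannian metric on $G$ for which the left-invariant frame $e_1=z\frac{\partial}{\partial z}$, $e_2=z\frac{\partial}{\partial x}$, $e_3=z\frac{\partial}{\partial y}$ is orthonormal. Let $X=ae_1+be_2+ce_3$ with $a,b,c\in\mathbb{R}$ and $\|X\|_g<1$, and let $F=\alpha+\beta$ be the Randers metric with $\alpha(p,v)=\sqrt{g_p(v,v)}$ and $\beta(p,v)=g_p(X(p),v)$. Let $f:G\to\mathbb{R}$ be a $C^\infty$ function and $\tilde F=e^{f}F$. Then $\tilde F$ is a Douglas metric (a Finsler metric whose Douglas curvature $$D^i{}_{jkl}=\frac{\partial^3}{\partial v^j\partial v^k\partial v^l}\Big(G^i-\frac{1}{n+1}\sum_m\frac{\partial G^m}{\partial v^m}\,v^i\Big),\qquad n=3,$$ with $g_{ij}=\frac12\frac{\partial^2\tilde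 F^2}{\partial v^i\partial v^j}$ and spray coefficients $G^i=\frac14\sum_{l}g^{il}\big(\sum_k v^k\frac{\partial^2\tilde F^2}{\partial x^k\partial v^l}-\frac{\partial\tilde F^2}{\partial x^l}\big)$ in the coordinates $(x^1,x^2,x^3)=(x,y,z)$, vanishes for all nonzero tangent vectors $v$) if and only if the following three equations hold at every point of $G$: $$bz\frac{\partial f}{\partial z}-az\frac{\partial f}{\partial x}=b,\qquad cz\frac{\partial f}{\partial x}-bz\frac{\partial f}{\partial y}=0,\qquad cz\frac{\partial f}{\partial z}-az\frac{\partial f}{\partial y}=c.$$ -/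

import Mathlib

open scoped ContDiff

namespace DouglasRanders

noncomputable section

/-! ### Finsler metrics on an open subset of `ℝⁿ` (in global coordinates)

Points `x` and tangent vectors `y` are both given by their `n` coordinates, and a Finsler metric
is a function `F x y`. -/

/-- The partial derivative `∂h/∂xⁱ` at `x`. -/
def pd {n : ℕ} (i : Fin n) (h : (Fin n → ℝ) → ℝ) (x : Fin n → ℝ) : ℝ :=
  lineDeriv ℝ h x (Pi.single i 1)

/-- The fundamental tensor `g_{ij}(x,y) = ½ ∂²(F²)/∂yⁱ∂yʲ`. -/
def fundamentalTensor {n : ℕ} (F : (Fin n → ℝ) → (Fin n → ℝ) → ℝ) (x y : Fin n → ℝ) :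
    Matrix (Fin n) (Fin n) ℝ :=
  Matrix.of fun i j => (1 / 2 : ℝ) * pd i (fun v => pd j (fun w => F x w ^ 2) v) y

/-- `F` is a Finsler metric on the open set `U`: smooth away from the zero section, positive,
positively homogeneous of degree one in `y`, with positive definite fundamental tensor. -/
structure IsFinslerMetric {n : ℕ} (U : Set (Fin n → ℝ))
    (F : (Fin n → ℝ) → (Fin n → ℝ) → ℝ) : Prop where
  smooth : ContDiffOn ℝ ∞ (fun q : (Fin n → ℝ) × (Fin n → ℝ) => F q.1 q.2) (U ×ˢ {0}ᶜ)
  pos : ∀ x ∈ U, ∀ y, y ≠ 0 → 0 < F x y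
  homogeneous : ∀ x ∈ U, ∀ y, ∀ r : ℝ, 0 < r → F x (r • y) = r * F x y
  posDef : ∀ x ∈ U, ∀ y, y ≠ 0 → (fundamentalTensor F x y).PosDef

/-- The spray coefficients
`Gⁱ = ¼ gⁱˡ ( yᵏ ∂²(F²)/∂xᵏ∂yˡ - ∂(F²)/∂xˡ )`. -/
def sprayCoeff {n : ℕ} (F : (Fin n → ℝ) → (Fin n → ℝ) → ℝ) (i : Fin n) (x y : Fin n → ℝ) : ℝ :=
  (1 / 4 : ℝ) * ∑ l, (fundamentalTensor F x y)⁻¹ i l *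
    ((∑ k, y k * pd k (fun u => pd l (fun w => F u w ^ 2) y) x) - pd l (fun u => F u y ^ 2) x)

/-- The Douglas curvature
`Dⁱ_{jkl} = ∂³/∂yʲ∂yᵏ∂yˡ ( Gⁱ - (n+1)⁻¹ (∂Gᵐ/∂yᵐ) yⁱ )`. -/
def douglasCurvature {n : ℕ} (F : (Fin n → ℝ) → (Fin n → ℝ) → ℝ) (i j k l : Fin n)
    (x y : Fin n → ℝ) : ℝ :=
  pd j (fun u => pd k (fun v => pd l (fun w =>
    sprayCoeff F i x w - 1 / ((n : ℝ) + 1) * (∑ m, pd m (fun s => sprayCoeff F m x s) w) * w i)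
      v) u) y

/-- A Douglas metric: a Finsler metric whose Douglas curvature vanishes (on the slit tangent
bundle). -/
def IsDouglasMetric {n : ℕ} (U : Set (Fin n → ℝ)) (F : (Fin n → ℝ) → (Fin n → ℝ) → ℝ) : Prop :=
  IsFinslerMetric U F ∧
    ∀ x ∈ U, ∀ y, y ≠ 0 → ∀ i j k l, douglasCurvature F i j k l x y = 0

/-! ### Randers metrics defined by a Riemannian metric `g` and a vector field `X` -/

/-- `α(x,y) = √(g_x(y,y))`. -/
def alpha {n : ℕ} (g : (Fin n → ℝ) → (Fin n → ℝ) → (Fin n → ℝ) → ℝ) (x y : Fin n → ℝ) : ℝ :=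
  √(g x y y)

/-- `β(x,y) = g_x(X(x),y)`. -/
def beta {n : ℕ} (g : (Fin n → ℝ) → (Fin n → ℝ) → (Fin n → ℝ) → ℝ)
    (X : (Fin n → ℝ) → (Fin n → ℝ)) (x y : Fin n → ℝ) : ℝ :=
  g x (X x) y

/-- The Randers function `F = α + β`. -/
def randers {n : ℕ} (g : (Fin n → ℝ) → (Fin n → ℝ) → (Fin n → ℝ) → ℝ)
    (X : (Fin n → ℝ) → (Fin n → ℝ)) (x y : Fin n → ℝ) : ℝ :=
  alpha g x y + beta g X x y

/-- The Finsler function `e^f F`, conformally related to `F`. -/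
def conformal {n : ℕ} (f : (Fin n → ℝ) → ℝ) (F : (Fin n → ℝ) → (Fin n → ℝ) → ℝ)
    (x y : Fin n → ℝ) : ℝ :=
  Real.exp (f x) * F x y

/-! ### The Lie group `ℝ² ⋊ ℝ⁺`

Coordinates are `p 0 = x`, `p 1 = y`, `p 2 = z`, with `z > 0`; `ℝ⁺` acts on `ℝ²` by dilations. -/

/-- The underlying manifold of `ℝ² ⋊ ℝ⁺`, an open half-space of `ℝ³`. -/
def G : Set (Fin 3 → ℝ) := {p | 0 < p 2}

/-- Left translation: `(x,y,z)·(x',y',z') = (x + z x', y + z y', z z')`. -/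
def leftMul (p q : Fin 3 → ℝ) : Fin 3 → ℝ :=
  ![p 0 + p 2 * q 0, p 1 + p 2 * q 1, p 2 * q 2]

instance : Group G where
  mul p q := ⟨leftMul p q, by
    have hp : 0 < p.1 2 := p.2
    have hq : 0 < q.1 2 := q.2
    simpa [G, leftMul] using mul_pos hp hq⟩
  one := ⟨![0, 0, 1], by simp [G]⟩
  inv p := ⟨![-(p.1 0 / p.1 2), -(p.1 1 / p.1 2), (p.1 2)⁻¹], by
    have hp : 0 < p.1 2 := p.2
    simpa [G] using hp⟩
  mul_assoc p q r := by
    apply Subtype.ext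
    change leftMul (leftMul p q) r = leftMul p (leftMul q r)
    ext i
    fin_cases i <;> simp [leftMul] <;> ring
  one_mul p := by
    apply Subtype.ext
    change leftMul ![0, 0, 1] p = p
    ext i
    fin_cases i <;> simp [leftMul]
  mul_one p := by
    apply Subtype.ext
    change leftMul p ![0, 0, 1] = p
    ext i
    fin_cases i <;> simp [leftMul]
  inv_mul_cancel p := by
    apply Subtype.ext
    have hp : p.1 2 ≠ 0 := ne_of_gt p.2
    change leftMul ![-(p.1 0 / p.1 2), -(p.1 1 / p.1 2), (p.1 2)⁻¹] p = ![0, 0, 1]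
    ext i
    fin_cases i <;> simp [leftMul] <;> field_simp <;> ring

/-- `e₁ = z ∂/∂z`. -/
def e₁ (p : Fin 3 → ℝ) : Fin 3 → ℝ := ![0, 0, p 2]

/-- `e₂ = z ∂/∂x`. -/
def e₂ (p : Fin 3 → ℝ) : Fin 3 → ℝ := ![p 2, 0, 0]

/-- `e₃ = z ∂/∂y`. -/
def e₃ (p : Fin 3 → ℝ) : Fin 3 → ℝ := ![0, p 2, 0]

/-- The Riemannian metric on `G` for which `e₁, e₂, e₃` is orthonormal:
`g = z⁻² (dx² + dy² + dz²)`. -/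
def metric (p v w : Fin 3 → ℝ) : ℝ := (v 0 * w 0 + v 1 * w 1 + v 2 * w 2) / p 2 ^ 2

/-- The vector field `X = a e₁ + b e₂ + c e₃`. -/
def fieldX (a b c : ℝ) (p : Fin 3 → ℝ) : Fin 3 → ℝ := a • e₁ p + b • e₂ p + c • e₃ p

theorem coe_mul_eq (p q : G) : ((p * q : G) : Fin 3 → ℝ) = leftMul p q := rfl

theorem isOpen_G : IsOpen G := isOpen_lt continuous_const (continuous_apply 2)

theorem metric_orthonormal (p : Fin 3 → ℝ) (hp : p ∈ G) :
    metric p (e₁ p) (e₁ p) = 1 ∧ metric p (e₂ p) (e₂ p) = 1 ∧ metric p (e₃ p) (e₃ p) = 1 ∧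
    metric p (e₁ p) (e₂ p) = 0 ∧ metric p (e₁ p) (e₃ p) = 0 ∧ metric p (e₂ p) (e₃ p) = 0 := by
  have h : p 2 ≠ 0 := ne_of_gt hp
  refine ⟨?_, ?_, ?_, ?_, ?_, ?_⟩ <;> simp [metric, e₁, e₂, e₃] <;> field_simp

/-- The differential of a left translation by `p` is multiplication by the `z`-coordinate. -/
theorem hasFDerivAt_leftMul (p q : Fin 3 → ℝ) :
    HasFDerivAt (leftMul p) (p 2 • ContinuousLinearMap.id ℝ (Fin 3 → ℝ)) q := by
  have h : leftMul p = fun q => ![p 0, p 1, 0] + p 2 • q := by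
    funext q i
    fin_cases i <;> simp [leftMul]
  rw [h]
  exact ((hasFDerivAt_id q).const_smul (p 2)).const_add _

/-- The fields `a e₁ + b e₂ + c e₃` are left-invariant. -/
theorem fieldX_leftInvariant (a b c : ℝ) (p q : Fin 3 → ℝ) :
    fderiv ℝ (leftMul p) q (fieldX a b c q) = fieldX a b c (leftMul p q) := by
  rw [(hasFDerivAt_leftMul p q).fderiv]
  ext i
  fin_cases i <;> simp [fieldX, e₁, e₂, e₃, leftMul] <;> ring

/-- The metric is left-invariant. -/
theorem metric_leftInvariant (p q v w : Fin 3 → ℝ) (hp : p ∈ G) :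
    metric (leftMul p q) (fderiv ℝ (leftMul p) q v) (fderiv ℝ (leftMul p) q w) =
      metric q v w := by
  have h : p 2 ≠ 0 := ne_of_gt hp
  rw [(hasFDerivAt_leftMul p q).fderiv]
  have h2 : leftMul p q 2 = p 2 * q 2 := by simp [leftMul]
  simp only [metric, h2, _root_.smul_apply, ContinuousLinearMap.id_apply,
    Pi.smul_apply, smul_eq_mul]
  rw [mul_pow, ← mul_div_mul_left (v 0 * w 0 + v 1 * w 1 + v 2 * w 2) (q 2 ^ 2) (pow_ne_zero 2 h)]
  congr 1
  ring

end

end DouglasRanders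

namespace DouglasRanders

noncomputable section

open Matrix Filter Topology

/-! ### Calculus of directional derivatives -/

/-! In the coordinates `(x, y, z)` the metric is `z⁻²` times the Euclidean one, so the Finsler
function is `h(x) (|y| + B·y)` with `h = e^f / z` and the constant vector `B = (b, c, a)`
(`conformal_randers_eq`). Only the factor `h` depends on the point, and it enters the spray only
through `s = ∇ log h`. The spray is `P y - ½ |y|² s + |y| A y`, where `A = ½ (B ⊗ s - s ⊗ B)`
(`sprayCoeff_of_conformal`, `randersSpray_eq`). Subtracting the trace removes `P`
(`sum_pd_randersSpray`), and quadratic terms have zero third derivative, so the Douglas curvature is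
the third derivative of `|y| A y` (`douglasCurvature_of_conformal`). It vanishes exactly when `A =
0`, that is, when `B` and `s` are linearly dependent at each point
(`isDouglasMetric_iff_of_conformal`). With `s = ∇f - (0, 0, 1/z)`, the three minors of the pair `(B,
s)` are the three equations. -/

theorem hasLineDerivAt_add {n : ℕ} {f g : (Fin n → ℝ) → ℝ} {f' g' : ℝ} {x v : Fin n → ℝ}
    (hf : HasLineDerivAt ℝ f f' x v) (hg : HasLineDerivAt ℝ g g' x v) :
    HasLineDerivAt ℝ (fun w => f w + g w) (f' + g') x v :=
  HasDerivAt.add hf hg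

theorem hasLineDerivAt_mul {n : ℕ} {f g : (Fin n → ℝ) → ℝ} {f' g' : ℝ} {x v : Fin n → ℝ}
    (hf : HasLineDerivAt ℝ f f' x v) (hg : HasLineDerivAt ℝ g g' x v) :
    HasLineDerivAt ℝ (fun w => f w * g w) (f' * g x + f x * g') x v := by
  simpa [HasLineDerivAt] using HasDerivAt.fun_mul hf hg

theorem hasLineDerivAt_const {n : ℕ} (r : ℝ) (x v : Fin n → ℝ) :
    HasLineDerivAt ℝ (fun _ => r) 0 x v :=
  hasDerivAt_const 0 r

theorem hasLineDerivAt_const_mul {n : ℕ} (r : ℝ) {f : (Fin n → ℝ) → ℝ} {f' : ℝ}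
    {x v : Fin n → ℝ} (hf : HasLineDerivAt ℝ f f' x v) :
    HasLineDerivAt ℝ (fun w => r * f w) (r * f') x v :=
  HasDerivAt.const_mul r hf

theorem hasLineDerivAt_pow {n : ℕ} {f : (Fin n → ℝ) → ℝ} {f' : ℝ} {x v : Fin n → ℝ}
    (hf : HasLineDerivAt ℝ f f' x v) (k : ℕ) :
    HasLineDerivAt ℝ (fun w => f w ^ k) (k * f x ^ (k - 1) * f') x v := by
  simpa [HasLineDerivAt] using HasDerivAt.fun_pow hf k

theorem hasLineDerivAt_inv {n : ℕ} {f : (Fin n → ℝ) → ℝ} {f' : ℝ} {x v : Fin n → ℝ}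
    (hf : HasLineDerivAt ℝ f f' x v) (h0 : f x ≠ 0) :
    HasLineDerivAt ℝ (fun w => (f w)⁻¹) (-f' / f x ^ 2) x v := by
  simpa [HasLineDerivAt] using HasDerivAt.fun_inv hf (by simpa using h0)

theorem hasLineDerivAt_dotProduct {n : ℕ} (u x v : Fin n → ℝ) :
    HasLineDerivAt ℝ (fun w => u ⬝ᵥ w) (u ⬝ᵥ v) x v := by
  have h : HasDerivAt (fun t : ℝ => u ⬝ᵥ x + t * (u ⬝ᵥ v)) (u ⬝ᵥ v) 0 := by
    simpa using ((hasDerivAt_id (0 : ℝ)).mul_const (u ⬝ᵥ v)).const_add (u ⬝ᵥ x)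
  simpa [HasLineDerivAt, dotProduct_add, dotProduct_smul] using h

theorem hasLineDerivAt_apply {n : ℕ} (i : Fin n) (x v : Fin n → ℝ) :
    HasLineDerivAt ℝ (fun w => w i) (v i) x v := by
  simpa using hasLineDerivAt_dotProduct (Pi.single i 1) x v

theorem pd_eq {n : ℕ} {i : Fin n} {f : (Fin n → ℝ) → ℝ} {f' : ℝ} {x : Fin n → ℝ}
    (hf : HasLineDerivAt ℝ f f' x (Pi.single i 1)) : pd i f x = f' :=
  hf.lineDeriv

/-- Closed formulas are available only away from the zero vector; local equality is what lets them
be substituted under a further derivative. -/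
theorem pd_congr {n : ℕ} {i : Fin n} {f g : (Fin n → ℝ) → ℝ} {x : Fin n → ℝ}
    (h : f =ᶠ[𝓝 x] g) : pd i f x = pd i g x :=
  h.lineDeriv_eq

theorem pd_const_mul {n : ℕ} (i : Fin n) (r : ℝ) (f : (Fin n → ℝ) → ℝ) (x : Fin n → ℝ) :
    pd i (fun w => r * f w) x = r * pd i f x :=
  deriv_const_mul_field (u := r) (v := fun t : ℝ => f (x + t • Pi.single i 1))

/-- Euler's identity for a positively homogeneous function of degree one. -/
theorem sum_mul_pd_of_homogeneous {n : ℕ} {P : (Fin n → ℝ) → ℝ} {y : Fin n → ℝ}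
    (hP : DifferentiableAt ℝ P y) (hom : ∀ r : ℝ, 0 < r → P (r • y) = r * P y) :
    ∑ m, pd m P y * y m = P y := by
  have h1 : HasLineDerivAt ℝ P (fderiv ℝ P y y) y y := hP.hasFDerivAt.hasLineDerivAt y
  -- Along the ray, `P (y + t • y) = (1 + t) * P y` for `t > -1`; this is compared with the value
  -- given by the differential.
  have h2 : HasLineDerivAt ℝ P (P y) y y := by
    have h : HasDerivAt (fun t : ℝ => (1 + t) * P y) (P y) 0 := by
      simpa using ((hasDerivAt_id (0 : ℝ)).const_add 1).mul_const (P y)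
    refine h.congr_of_eventuallyEq ?_
    filter_upwards [lt_mem_nhds (show (-1 : ℝ) < 0 by norm_num)] with t ht
    rw [← hom (1 + t) (by linarith), add_smul, one_smul]
  refine Eq.trans ?_ (h1.unique h2)
  conv_rhs => rw [← Finset.univ_sum_single y, map_sum]
  refine Finset.sum_congr rfl fun m _ => ?_
  rw [pd, hP.lineDeriv_eq_fderiv, mul_comm, ← smul_eq_mul, ← map_smul, ← Pi.single_smul,
    smul_eq_mul, mul_one, Finset.univ_sum_single]

/-! ### The Randers norm `|y| + B·y` on `ℝⁿ` -/

/-- The Euclidean length `|y|`. -/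
def euclLength {n : ℕ} (y : Fin n → ℝ) : ℝ := √(y ⬝ᵥ y)

/-- The Randers–Minkowski norm `|y| + B·y`. -/
def randersNorm {n : ℕ} (B y : Fin n → ℝ) : ℝ := euclLength y + B ⬝ᵥ y

theorem dotProduct_self_pos {n : ℕ} {y : Fin n → ℝ} (hy : y ≠ 0) : 0 < y ⬝ᵥ y :=
  lt_of_le_of_ne (by simpa using dotProduct_star_self_nonneg y)
    fun h => hy (dotProduct_self_eq_zero.1 h.symm)

theorem euclLength_pos {n : ℕ} {y : Fin n → ℝ} (hy : y ≠ 0) : 0 < euclLength y :=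
  Real.sqrt_pos.2 (dotProduct_self_pos hy)

theorem euclLength_sq {n : ℕ} (y : Fin n → ℝ) : euclLength y ^ 2 = y ⬝ᵥ y :=
  Real.sq_sqrt (by simpa using dotProduct_star_self_nonneg y)

theorem euclLength_smul {n : ℕ} {r : ℝ} (hr : 0 < r) (y : Fin n → ℝ) :
    euclLength (r • y) = r * euclLength y := by
  rw [euclLength, smul_dotProduct, dotProduct_smul, smul_eq_mul, smul_eq_mul, ← mul_assoc,
    Real.sqrt_mul (by positivity), Real.sqrt_mul_self hr.le, euclLength]

theorem dotProduct_sq_le {n : ℕ} (u v : Fin n → ℝ) : (u ⬝ᵥ v) ^ 2 ≤ (u ⬝ᵥ u) * (v ⬝ᵥ v) := by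
  simpa [dotProduct, pow_two] using Finset.sum_mul_sq_le_sq_mul_sq Finset.univ u v

theorem randersNorm_pos {n : ℕ} {B y : Fin n → ℝ} (hB : B ⬝ᵥ B < 1) (hy : y ≠ 0) :
    0 < randersNorm B y := by
  have h1 := dotProduct_sq_le B y
  have h2 := dotProduct_self_pos hy
  have h3 := euclLength_pos hy
  have h4 : (B ⬝ᵥ y) ^ 2 < euclLength y ^ 2 := by rw [euclLength_sq]; nlinarith
  have h5 := abs_lt_of_sq_lt_sq h4 h3.le
  rw [randersNorm]
  linarith [(abs_lt.1 h5).1]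

theorem randersNorm_smul {n : ℕ} (B : Fin n → ℝ) {r : ℝ} (hr : 0 < r) (y : Fin n → ℝ) :
    randersNorm B (r • y) = r * randersNorm B y := by
  rw [randersNorm, euclLength_smul hr, dotProduct_smul, smul_eq_mul, randersNorm, mul_add]

theorem contDiffAt_euclLength {n : ℕ} {y : Fin n → ℝ} (hy : y ≠ 0) :
    ContDiffAt ℝ ∞ (euclLength (n := n)) y := by
  unfold euclLength dotProduct
  refine ContDiffAt.sqrt (by fun_prop) ?_
  exact (dotProduct_self_pos hy).ne'

theorem hasLineDerivAt_euclLength {n : ℕ} {y : Fin n → ℝ} (hy : y ≠ 0) (v : Fin n → ℝ) :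
    HasLineDerivAt ℝ euclLength (y ⬝ᵥ v / euclLength y) y v := by
  have h1 : HasLineDerivAt ℝ (fun w : Fin n → ℝ => w ⬝ᵥ w) (2 * (y ⬝ᵥ v)) y v := by
    have h : HasDerivAt (fun t : ℝ => y ⬝ᵥ y + t * (2 * (y ⬝ᵥ v)) + t ^ 2 * (v ⬝ᵥ v))
        (2 * (y ⬝ᵥ v)) 0 := by
      simpa using (((hasDerivAt_id (0 : ℝ)).mul_const (2 * (y ⬝ᵥ v))).const_add (y ⬝ᵥ y)).fun_add
        ((hasDerivAt_pow 2 (0 : ℝ)).mul_const (v ⬝ᵥ v))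
    refine h.congr_of_eventuallyEq (Eventually.of_forall fun t => ?_)
    simp only [dotProduct_add, add_dotProduct, dotProduct_smul, smul_dotProduct, smul_eq_mul,
      dotProduct_comm v y]
    ring
  have h2 := HasDerivAt.sqrt h1 (by simpa using (dotProduct_self_pos hy).ne')
  have h3 : y ⬝ᵥ v / euclLength y = 2 * (y ⬝ᵥ v) / (2 * √((y + (0 : ℝ) • v) ⬝ᵥ (y + (0 : ℝ) • v))) := by
    rw [zero_smul, add_zero, mul_div_mul_left _ _ two_ne_zero, euclLength]
  rw [h3]
  exact h2

theorem hasLineDerivAt_randersNorm {n : ℕ} (B : Fin n → ℝ) {y : Fin n → ℝ} (hy : y ≠ 0)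
    (v : Fin n → ℝ) :
    HasLineDerivAt ℝ (randersNorm B) (y ⬝ᵥ v / euclLength y + B ⬝ᵥ v) y v :=
  hasLineDerivAt_add (hasLineDerivAt_euclLength hy v) (hasLineDerivAt_dotProduct B y v)

theorem hasLineDerivAt_dotProduct_div_euclLength {n : ℕ} {y : Fin n → ℝ} (hy : y ≠ 0)
    (u v : Fin n → ℝ) :
    HasLineDerivAt ℝ (fun w => u ⬝ᵥ w / euclLength w)
      (u ⬝ᵥ v / euclLength y - (u ⬝ᵥ y) * (y ⬝ᵥ v) / euclLength y ^ 3) y v := by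
  have h0 := (euclLength_pos hy).ne'
  have h := hasLineDerivAt_mul (hasLineDerivAt_dotProduct u y v)
    (hasLineDerivAt_inv (hasLineDerivAt_euclLength hy v) h0)
  have e : u ⬝ᵥ v / euclLength y - (u ⬝ᵥ y) * (y ⬝ᵥ v) / euclLength y ^ 3 =
      u ⬝ᵥ v * (euclLength y)⁻¹ + u ⬝ᵥ y * (-(y ⬝ᵥ v / euclLength y) / euclLength y ^ 2) := by
    field_simp
    ring
  rw [e]
  exact h

theorem eventually_ne_zero {n : ℕ} {y : Fin n → ℝ} (hy : y ≠ 0) : ∀ᶠ w in 𝓝 y, w ≠ 0 :=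
  isOpen_ne.mem_nhds hy

theorem pd_randersNorm_sq {n : ℕ} (B : Fin n → ℝ) {y : Fin n → ℝ} (hy : y ≠ 0) (l : Fin n) :
    pd l (fun w => randersNorm B w ^ 2) y =
      2 * randersNorm B y * (y l / euclLength y + B l) := by
  rw [pd_eq (hasLineDerivAt_pow (hasLineDerivAt_randersNorm B hy _) 2)]
  simp

/-- The fundamental tensor of the Randers norm. -/
def randersTensor {n : ℕ} (B y : Fin n → ℝ) : Matrix (Fin n) (Fin n) ℝ :=
  (randersNorm B y / euclLength y) • (1 : Matrix (Fin n) (Fin n) ℝ)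
    - (randersNorm B y / euclLength y ^ 3) • vecMulVec y y
    + vecMulVec ((euclLength y)⁻¹ • y + B) ((euclLength y)⁻¹ • y + B)

theorem half_pd_pd_randersNorm_sq {n : ℕ} (B : Fin n → ℝ) {y : Fin n → ℝ} (hy : y ≠ 0)
    (i j : Fin n) :
    1 / 2 * pd i (fun v => pd j (fun w => randersNorm B w ^ 2) v) y = randersTensor B y i j := by
  have h : (fun v => pd j (fun w => randersNorm B w ^ 2) v) =ᶠ[𝓝 y]
      fun v => 2 * (randersNorm B v * (Pi.single j 1 ⬝ᵥ v / euclLength v + B j)) := by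
    filter_upwards [eventually_ne_zero hy] with v hv
    rw [pd_randersNorm_sq B hv, single_one_dotProduct, mul_assoc]
  rw [pd_congr h, pd_eq (hasLineDerivAt_const_mul 2 (hasLineDerivAt_mul
    (hasLineDerivAt_randersNorm B hy _) (hasLineDerivAt_add
      (hasLineDerivAt_dotProduct_div_euclLength hy (Pi.single j 1) _)
      (hasLineDerivAt_const (B j) _ _))))]
  simp only [single_one_dotProduct, dotProduct_single_one, randersTensor, Matrix.add_apply,
    Matrix.sub_apply, Matrix.smul_apply, Matrix.one_apply, vecMulVec_apply, Pi.add_apply,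
    Pi.smul_apply, smul_eq_mul, Pi.single_apply]
  split_ifs <;> ring

theorem randersTensor_mulVec {n : ℕ} (B y v : Fin n → ℝ) :
    randersTensor B y *ᵥ v = (randersNorm B y / euclLength y) • v
      - (randersNorm B y / euclLength y ^ 3 * (y ⬝ᵥ v)) • y
      + (y ⬝ᵥ v / euclLength y + B ⬝ᵥ v) • ((euclLength y)⁻¹ • y + B) := by
  ext i
  simp only [randersTensor, add_mulVec, sub_mulVec, smul_mulVec, vecMulVec_mulVec, one_mulVec,
    Pi.add_apply, Pi.sub_apply, Pi.smul_apply, smul_eq_mul, add_dotProduct, smul_dotProduct,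
    op_smul_eq_smul]
  ring

/-- The first two terms form a positive multiple of the Cauchy–Schwarz defect of `y` and `v`, and
the last is a square. Both vanish together only if `v ⬝ᵥ v = (B ⬝ᵥ v) ^ 2`, which `|B| < 1` forbids
for `v ≠ 0`. -/
theorem fundamentalForm_pos {n : ℕ} {B y v : Fin n → ℝ} (hB : B ⬝ᵥ B < 1) (hy : y ≠ 0)
    (hv : v ≠ 0) :
    0 < randersNorm B y / euclLength y * (v ⬝ᵥ v)
      - randersNorm B y / euclLength y ^ 3 * (y ⬝ᵥ v) ^ 2
      + (y ⬝ᵥ v / euclLength y + B ⬝ᵥ v) ^ 2 := by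
  have hα := euclLength_pos hy
  have hφ := randersNorm_pos hB hy
  have hs := euclLength_sq y
  have hvv := dotProduct_self_pos hv
  have h1 := dotProduct_sq_le y v
  have h2 := dotProduct_sq_le B v
  generalize randersNorm B y = φ at *
  generalize euclLength y = α at *
  rw [← hs] at h1
  generalize v ⬝ᵥ v = N at *
  generalize y ⬝ᵥ v = p at *
  generalize B ⬝ᵥ v = q at *
  generalize B ⬝ᵥ B = b at *
  have e : φ / α * N - φ / α ^ 3 * p ^ 2 + (p / α + q) ^ 2 =
      φ / α ^ 3 * (α ^ 2 * N - p ^ 2) + (p / α + q) ^ 2 := by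
    field_simp
  rw [e]
  rcases h1.lt_or_eq with h | h
  · have : 0 < φ / α ^ 3 * (α ^ 2 * N - p ^ 2) := mul_pos (by positivity) (by linarith)
    positivity
  · rw [h, sub_self, mul_zero, zero_add]
    refine sq_pos_of_ne_zero ?_
    intro h0
    have h3 : p = -(α * q) := by field_simp at h0; linarith
    have h4 : α ^ 2 * N = α ^ 2 * q ^ 2 := by rw [← h, h3]; ring
    have h5 : N = q ^ 2 := mul_left_cancel₀ (by positivity) h4
    nlinarith

theorem randersTensor_posDef {n : ℕ} {B y : Fin n → ℝ} (hB : B ⬝ᵥ B < 1) (hy : y ≠ 0) :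
    (randersTensor B y).PosDef := by
  refine PosDef.of_dotProduct_mulVec_pos ?_ fun v hv => ?_
  · ext i j
    simp only [randersTensor, conjTranspose_apply, star_trivial, Matrix.add_apply,
      Matrix.sub_apply, Matrix.smul_apply, Matrix.one_apply, vecMulVec_apply, smul_eq_mul,
      eq_comm (a := i)]
    ring
  · refine (fundamentalForm_pos hB hy hv).trans_eq ?_
    simp only [randersTensor_mulVec, star_trivial, dotProduct_comm v, add_dotProduct,
      sub_dotProduct, smul_dotProduct, smul_eq_mul]
    ring

/-! ### Conformal changes of the Randers norm -/

/-- The spray coefficients of `h(x) (|y| + B·y)`, where `s` is the gradient of `log h`. -/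
def randersSpray {n : ℕ} (B s y : Fin n → ℝ) : Fin n → ℝ :=
  (s ⬝ᵥ y) • y - (1 / 2 : ℝ) • ((euclLength y * randersNorm B y) • s
    + ((euclLength y * (B ⬝ᵥ B) + B ⬝ᵥ y) / randersNorm B y * (s ⬝ᵥ y)) • y
    - euclLength y • ((s ⬝ᵥ y) • B + (B ⬝ᵥ s) • y))

/-- Verifying the candidate spray against the tensor avoids inverting it. The right side, times `4
h²`, is the bracket in the definition of the spray coefficients. -/
theorem randersTensor_mulVec_randersSpray {n : ℕ} {B y : Fin n → ℝ} (hB : B ⬝ᵥ B < 1)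
    (hy : y ≠ 0) (s : Fin n → ℝ) :
    randersTensor B y *ᵥ randersSpray B s y =
      ((s ⬝ᵥ y) * randersNorm B y) • ((euclLength y)⁻¹ • y + B)
        - (1 / 2 * randersNorm B y ^ 2) • s := by
  have hα := (euclLength_pos hy).ne'
  have hφ := (randersNorm_pos hB hy).ne'
  have hs := euclLength_sq y
  have hβ : B ⬝ᵥ y = randersNorm B y - euclLength y := by rw [randersNorm]; ring
  rw [randersTensor_mulVec, randersSpray]
  simp only [dotProduct_add, dotProduct_sub, dotProduct_smul, smul_eq_mul, dotProduct_comm y B,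
    dotProduct_comm y s, ← hs, hβ]
  generalize randersNorm B y = φ at *
  generalize euclLength y = α at *
  ext i
  simp only [Pi.add_apply, Pi.sub_apply, Pi.smul_apply, smul_eq_mul]
  field_simp
  ring

section Conformal

variable {n : ℕ} {F : (Fin n → ℝ) → (Fin n → ℝ) → ℝ} {U : Set (Fin n → ℝ)}
  {h : (Fin n → ℝ) → ℝ} {B : Fin n → ℝ}

theorem pd_sq_of_conformal (hF : ∀ u ∈ U, ∀ w, F u w = h u * randersNorm B w)
    {x : Fin n → ℝ} (hx : x ∈ U) (l : Fin n) (y : Fin n → ℝ) :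
    pd l (fun w => F x w ^ 2) y = h x ^ 2 * pd l (fun w => randersNorm B w ^ 2) y := by
  simp only [hF x hx, mul_pow, pd_const_mul]

theorem fundamentalTensor_of_conformal (hF : ∀ u ∈ U, ∀ w, F u w = h u * randersNorm B w)
    {x y : Fin n → ℝ} (hx : x ∈ U) (hy : y ≠ 0) :
    fundamentalTensor F x y = h x ^ 2 • randersTensor B y := by
  ext i j
  simp only [fundamentalTensor, Matrix.of_apply, Matrix.smul_apply, smul_eq_mul,
    pd_sq_of_conformal hF hx, pd_const_mul, ← half_pd_pd_randersNorm_sq B hy]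
  ring

theorem sprayCoeff_of_conformal (hF : ∀ u ∈ U, ∀ w, F u w = h u * randersNorm B w)
    (hU : IsOpen U) {x y s : Fin n → ℝ} (hx : x ∈ U) (hB : B ⬝ᵥ B < 1) (hpos : 0 < h x)
    (hs : ∀ k, HasLineDerivAt ℝ h (h x * s k) x (Pi.single k 1)) (hy : y ≠ 0) (i : Fin n) :
    sprayCoeff F i x y = randersSpray B s y i := by
  have hsq : ∀ k (r : ℝ), pd k (fun u => h u ^ 2 * r) x = 2 * h x ^ 2 * s k * r := by
    intro k r
    rw [pd_eq (hasLineDerivAt_mul (hasLineDerivAt_pow (hs k) 2) (hasLineDerivAt_const r _ _))]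
    push_cast
    ring
  have h1 : ∀ l, ((∑ k, y k * pd k (fun u => pd l (fun w => F u w ^ 2) y) x)
      - pd l (fun u => F u y ^ 2) x) =
      ((h x ^ 2 • randersTensor B y) *ᵥ ((4 : ℝ) • randersSpray B s y)) l := by
    intro l
    have e1 : ∀ k, pd k (fun u => pd l (fun w => F u w ^ 2) y) x =
        2 * h x ^ 2 * s k * pd l (fun w => randersNorm B w ^ 2) y := fun k => by
      rw [← hsq]
      refine pd_congr ?_
      filter_upwards [hU.mem_nhds hx] with u hu
      exact pd_sq_of_conformal hF hu l y
    have e2 : pd l (fun u => F u y ^ 2) x = 2 * h x ^ 2 * s l * randersNorm B y ^ 2 := by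
      rw [← hsq]
      refine pd_congr ?_
      filter_upwards [hU.mem_nhds hx] with u hu
      rw [hF u hu, mul_pow]
    have e3 : ∑ k, y k * (2 * h x ^ 2 * s k * pd l (fun w => randersNorm B w ^ 2) y) =
        2 * h x ^ 2 * (s ⬝ᵥ y) * pd l (fun w => randersNorm B w ^ 2) y := by
      simp only [dotProduct, Finset.mul_sum, Finset.sum_mul]
      exact Finset.sum_congr rfl fun k _ => by ring
    simp only [e1, e3]
    simp only [e2, pd_randersNorm_sq B hy, smul_mulVec, mulVec_smul,
      randersTensor_mulVec_randersSpray hB hy, Pi.smul_apply, Pi.sub_apply, Pi.add_apply,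
      smul_eq_mul]
    ring
  -- Positive definiteness supplies the invertibility needed to cancel the tensor.
  have hdet : IsUnit (h x ^ 2 • randersTensor B y).det :=
    ((randersTensor_posDef hB hy).smul (pow_pos hpos 2)).det_pos.ne'.isUnit
  rw [sprayCoeff, fundamentalTensor_of_conformal hF hx hy]
  simp only [h1]
  change 1 / 4 * ((h x ^ 2 • randersTensor B y)⁻¹ *ᵥ
    ((h x ^ 2 • randersTensor B y) *ᵥ ((4 : ℝ) • randersSpray B s y))) i = _
  rw [mulVec_mulVec, nonsing_inv_mul _ hdet, one_mulVec, Pi.smul_apply, smul_eq_mul]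
  ring

theorem isFinslerMetric_of_conformal (hF : ∀ u ∈ U, ∀ w, F u w = h u * randersNorm B w)
    (hB : B ⬝ᵥ B < 1) (hpos : ∀ u ∈ U, 0 < h u) (hh : ContDiffOn ℝ ∞ h U) :
    IsFinslerMetric U F where
  smooth := by
    have h1 : ContDiffOn ℝ ∞ (fun q : (Fin n → ℝ) × (Fin n → ℝ) => h q.1) (U ×ˢ {0}ᶜ) :=
      hh.comp contDiffOn_fst fun q hq => hq.1
    have h2 : ContDiffOn ℝ ∞ (fun q : (Fin n → ℝ) × (Fin n → ℝ) => randersNorm B q.2)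
        (U ×ˢ {0}ᶜ) := fun q hq =>
      (ContDiffAt.comp q (g := randersNorm B) ((contDiffAt_euclLength hq.2).add
        (by unfold dotProduct; fun_prop)) contDiffAt_snd).contDiffWithinAt
    exact (h1.mul h2).congr fun q hq => hF q.1 hq.1 q.2
  pos x hx y hy := by
    rw [hF x hx]
    exact mul_pos (hpos x hx) (randersNorm_pos hB hy)
  homogeneous x hx y r hr := by
    rw [hF x hx, hF x hx, randersNorm_smul B hr]
    ring
  posDef x hx y hy := by
    rw [fundamentalTensor_of_conformal hF hx hy]
    exact (randersTensor_posDef hB hy).smul (pow_pos (hpos x hx) 2)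

end Conformal

/-! ### The Douglas curvature of a conformally changed Randers norm -/

/-- The rows of the skew-symmetric matrix `½ (B ⊗ s - s ⊗ B)`. -/
def skewRow {n : ℕ} (B s : Fin n → ℝ) (i : Fin n) : Fin n → ℝ :=
  (1 / 2 : ℝ) • (B i • s - s i • B)

theorem skewRow_self {n : ℕ} (B s : Fin n → ℝ) (i : Fin n) : skewRow B s i i = 0 := by
  simp only [skewRow, Pi.smul_apply, Pi.sub_apply, smul_eq_mul]
  ring

theorem skewRow_dotProduct {n : ℕ} (B s y : Fin n → ℝ) (i : Fin n) :
    skewRow B s i ⬝ᵥ y = 1 / 2 * (B i * (s ⬝ᵥ y) - s i * (B ⬝ᵥ y)) := by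
  simp only [skewRow, smul_dotProduct, sub_dotProduct, smul_eq_mul]

/-- Skew-symmetry; this removes the derivative of `|y|` in the `|y| A y` term from the divergence.
-/
theorem sum_skewRow_dotProduct_mul {n : ℕ} (B s y : Fin n → ℝ) :
    ∑ m, y m * (skewRow B s m ⬝ᵥ y) = 0 := by
  have h : ∀ m, y m * (skewRow B s m ⬝ᵥ y) =
      1 / 2 * ((s ⬝ᵥ y) * (B m * y m) - (B ⬝ᵥ y) * (s m * y m)) := fun m => by
    rw [skewRow_dotProduct]
    ring
  simp only [h, ← Finset.mul_sum, Finset.sum_sub_distrib]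
  change 1 / 2 * ((s ⬝ᵥ y) * (B ⬝ᵥ y) - (B ⬝ᵥ y) * (s ⬝ᵥ y)) = 0
  ring

/-- The projective factor of the spray. -/
def projFactor {n : ℕ} (B s y : Fin n → ℝ) : ℝ :=
  s ⬝ᵥ y - 1 / 2 * ((euclLength y * (B ⬝ᵥ B) + B ⬝ᵥ y) / randersNorm B y * (s ⬝ᵥ y))
    + 1 / 2 * (euclLength y * (B ⬝ᵥ s))

theorem randersSpray_eq {n : ℕ} (B s y : Fin n → ℝ) (i : Fin n) :
    randersSpray B s y i = projFactor B s y * y i +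
      (-(1 / 2) * s i * euclLength y ^ 2 + euclLength y * (skewRow B s i ⬝ᵥ y)) := by
  simp only [randersSpray, projFactor, skewRow_dotProduct, Pi.add_apply, Pi.sub_apply,
    Pi.smul_apply, smul_eq_mul]
  have h : randersNorm B y * s i = euclLength y * s i + B ⬝ᵥ y * s i := by
    rw [randersNorm, add_mul]
  linear_combination (-(1 / 2) * euclLength y) * h

theorem projFactor_smul {n : ℕ} (B s y : Fin n → ℝ) {r : ℝ} (hr : 0 < r) :
    projFactor B s (r • y) = r * projFactor B s y := by
  have h : (r * euclLength y * (B ⬝ᵥ B) + r * (B ⬝ᵥ y)) / (r * randersNorm B y) =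
      (euclLength y * (B ⬝ᵥ B) + B ⬝ᵥ y) / randersNorm B y := by
    rw [mul_assoc, ← mul_add, mul_div_mul_left _ _ hr.ne']
  simp only [projFactor, euclLength_smul hr, randersNorm_smul B hr, dotProduct_smul, smul_eq_mul, h]
  ring

theorem differentiableAt_projFactor {n : ℕ} {B y : Fin n → ℝ} (hB : B ⬝ᵥ B < 1) (hy : y ≠ 0)
    (s : Fin n → ℝ) : DifferentiableAt ℝ (projFactor B s) y := by
  have hα : DifferentiableAt ℝ (euclLength (n := n)) y :=
    (contDiffAt_euclLength hy).differentiableAt (by simp)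
  have hd : ∀ u : Fin n → ℝ, DifferentiableAt ℝ (fun w => u ⬝ᵥ w) y := fun u => by
    unfold dotProduct
    fun_prop
  have hφ : DifferentiableAt ℝ (randersNorm B) y := hα.add (hd B)
  unfold projFactor
  simp only [div_eq_mul_inv]
  exact ((hd s).sub (((((hα.mul_const _).add (hd B)).mul (hφ.inv
    (randersNorm_pos hB hy).ne')).mul (hd s)).const_mul _)).add ((hα.mul_const _).const_mul _)

/-- Euler's identity gives `(n + 1) P` as the divergence of `P y`, the quadratic term gives `-s·y`,
and `|y| A y` gives nothing, since `A` is skew. The factor `n + 1` matches the normalisation in the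
Douglas curvature, so `P` cancels there. -/
theorem sum_pd_randersSpray {n : ℕ} {B y : Fin n → ℝ} (hB : B ⬝ᵥ B < 1) (hy : y ≠ 0)
    (s : Fin n → ℝ) :
    ∑ m, pd m (fun w => randersSpray B s w m) y =
      ((n : ℝ) + 1) * projFactor B s y - s ⬝ᵥ y := by
  have hα := (euclLength_pos hy).ne'
  have hP := differentiableAt_projFactor hB hy s
  have h : ∀ m, pd m (fun w => randersSpray B s w m) y =
      pd m (projFactor B s) y * y m + projFactor B s y - s m * y m
        + (euclLength y)⁻¹ * (y m * (skewRow B s m ⬝ᵥ y)) := fun m => by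
    simp only [randersSpray_eq]
    rw [pd_eq (hasLineDerivAt_add (hasLineDerivAt_mul
      (hP.lineDifferentiableAt (v := Pi.single m 1)).hasLineDerivAt (hasLineDerivAt_apply m y _))
      (hasLineDerivAt_add (hasLineDerivAt_const_mul _
        (hasLineDerivAt_pow (hasLineDerivAt_euclLength hy _) 2))
        (hasLineDerivAt_mul (hasLineDerivAt_euclLength hy _)
          (hasLineDerivAt_dotProduct (skewRow B s m) y _))))]
    simp only [dotProduct_single_one, skewRow_self, Pi.single_eq_same, pd]
    field_simp
    push_cast
    ring
  simp only [h, Finset.sum_add_distrib, Finset.sum_sub_distrib, ← Finset.mul_sum,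
    sum_skewRow_dotProduct_mul, sum_mul_pd_of_homogeneous hP fun r hr => projFactor_smul B s y hr,
    Finset.sum_const, Finset.card_univ, Fintype.card_fin, nsmul_eq_mul]
  change _ - s ⬝ᵥ y + _ = _
  ring

/-- The third derivative of `|y| (u·y)`; the quadratic terms do not contribute. -/
theorem pd_pd_pd_euclLength_mul_add_quadratic {n : ℕ} (u s : Fin n → ℝ) (r q : ℝ)
    {y : Fin n → ℝ} (hy : y ≠ 0) (i j k l : Fin n) :
    pd j (fun v => pd k (fun v => pd l (fun w =>
      euclLength w * (u ⬝ᵥ w) + (r * euclLength w ^ 2 + q * ((s ⬝ᵥ w) * w i))) v) v) y =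
    ((Pi.single l 1 : Fin n → ℝ) k / euclLength y - y l * y k / euclLength y ^ 3) * u j
      + ((Pi.single l 1 : Fin n → ℝ) j / euclLength y - y l * y j / euclLength y ^ 3) * u k
      + ((Pi.single k 1 : Fin n → ℝ) j / euclLength y - y k * y j / euclLength y ^ 3) * u l
      + (3 * (y l * y k * y j) / euclLength y ^ 5
          - ((Pi.single l 1 : Fin n → ℝ) k * y j + (Pi.single l 1 : Fin n → ℝ) j * y k
            + (Pi.single k 1 : Fin n → ℝ) j * y l) / euclLength y ^ 3) * (u ⬝ᵥ y) := by
  have h1 : ∀ v : Fin n → ℝ, v ≠ 0 → pd l (fun w =>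
      euclLength w * (u ⬝ᵥ w) + (r * euclLength w ^ 2 + q * ((s ⬝ᵥ w) * w i))) v =
      v l * (u ⬝ᵥ v / euclLength v) + (euclLength v * u l + (2 * r * v l +
        q * (s l * v i + (s ⬝ᵥ v) * (Pi.single l 1 : Fin n → ℝ) i))) := fun v hv => by
    have hα := (euclLength_pos hv).ne'
    rw [pd_eq (hasLineDerivAt_add (hasLineDerivAt_mul (hasLineDerivAt_euclLength hv _)
      (hasLineDerivAt_dotProduct u v _)) (hasLineDerivAt_add (hasLineDerivAt_const_mul r
        (hasLineDerivAt_pow (hasLineDerivAt_euclLength hv _) 2))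
        (hasLineDerivAt_const_mul q (hasLineDerivAt_mul (hasLineDerivAt_dotProduct s v _)
          (hasLineDerivAt_apply i v _)))))]
    simp only [dotProduct_single_one]
    field_simp
    push_cast
    ring
  -- Written in the quotients `w ⬝ᵥ v / euclLength v`, so that one derivative formula suffices for
  -- the last step; the quadratic terms are already constants.
  have h2 : ∀ v : Fin n → ℝ, v ≠ 0 → pd k (fun v => pd l (fun w =>
      euclLength w * (u ⬝ᵥ w) + (r * euclLength w ^ 2 + q * ((s ⬝ᵥ w) * w i))) v) v =
      (2 * r * (Pi.single k 1 : Fin n → ℝ) l + q * (s l * (Pi.single k 1 : Fin n → ℝ) i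
          + s k * (Pi.single l 1 : Fin n → ℝ) i))
        + ((Pi.single k 1 : Fin n → ℝ) l * (u ⬝ᵥ v / euclLength v)
        + (-1 * ((Pi.single l 1 ⬝ᵥ v / euclLength v) * ((Pi.single k 1 ⬝ᵥ v / euclLength v)
          * (u ⬝ᵥ v / euclLength v)))
        + (u k * (Pi.single l 1 ⬝ᵥ v / euclLength v)
          + u l * (Pi.single k 1 ⬝ᵥ v / euclLength v)))) := fun v hv => by
    have hα := (euclLength_pos hv).ne'
    rw [pd_congr ((eventually_ne_zero hv).mono h1),
      pd_eq (hasLineDerivAt_add (hasLineDerivAt_mul (hasLineDerivAt_apply l v _)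
        (hasLineDerivAt_dotProduct_div_euclLength hv u _)) (hasLineDerivAt_add
          (hasLineDerivAt_mul (hasLineDerivAt_euclLength hv _) (hasLineDerivAt_const (u l) v _))
          (hasLineDerivAt_add (hasLineDerivAt_const_mul (2 * r) (hasLineDerivAt_apply l v _))
            (hasLineDerivAt_const_mul q (hasLineDerivAt_add
              (hasLineDerivAt_const_mul (s l) (hasLineDerivAt_apply i v _))
              (hasLineDerivAt_mul (hasLineDerivAt_dotProduct s v _)
                (hasLineDerivAt_const _ v _)))))))]
    simp only [dotProduct_single_one, single_one_dotProduct]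
    field_simp
    ring
  have hα := (euclLength_pos hy).ne'
  have hD := fun w : Fin n → ℝ =>
    hasLineDerivAt_dotProduct_div_euclLength hy w (Pi.single j 1)
  rw [pd_congr ((eventually_ne_zero hy).mono h2),
    pd_eq (hasLineDerivAt_add (hasLineDerivAt_const _ y _) (hasLineDerivAt_add
      (hasLineDerivAt_const_mul _ (hD u)) (hasLineDerivAt_add
        (hasLineDerivAt_const_mul (-1) (hasLineDerivAt_mul (hD (Pi.single l 1))
          (hasLineDerivAt_mul (hD (Pi.single k 1)) (hD u))))
        (hasLineDerivAt_add (hasLineDerivAt_const_mul (u k) (hD (Pi.single l 1)))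
          (hasLineDerivAt_const_mul (u l) (hD (Pi.single k 1)))))))]
  have hkl : (Pi.single k 1 : Fin n → ℝ) l = (Pi.single l 1 : Fin n → ℝ) k := by
    simp only [Pi.single_apply, eq_comm]
  simp only [dotProduct_single_one, single_one_dotProduct, hkl]
  field_simp
  ring

section Conformal

variable {n : ℕ} {F : (Fin n → ℝ) → (Fin n → ℝ) → ℝ} {U : Set (Fin n → ℝ)}
  {h : (Fin n → ℝ) → ℝ} {B : Fin n → ℝ}

theorem douglasCurvature_of_conformal (hF : ∀ u ∈ U, ∀ w, F u w = h u * randersNorm B w)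
    (hU : IsOpen U) {x y s : Fin n → ℝ} (hx : x ∈ U) (hB : B ⬝ᵥ B < 1) (hpos : 0 < h x)
    (hs : ∀ k, HasLineDerivAt ℝ h (h x * s k) x (Pi.single k 1)) (hy : y ≠ 0) (i j k l : Fin n) :
    douglasCurvature F i j k l x y =
    ((Pi.single l 1 : Fin n → ℝ) k / euclLength y - y l * y k / euclLength y ^ 3)
        * skewRow B s i j
      + ((Pi.single l 1 : Fin n → ℝ) j / euclLength y - y l * y j / euclLength y ^ 3)
        * skewRow B s i k
      + ((Pi.single k 1 : Fin n → ℝ) j / euclLength y - y k * y j / euclLength y ^ 3)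
        * skewRow B s i l
      + (3 * (y l * y k * y j) / euclLength y ^ 5
          - ((Pi.single l 1 : Fin n → ℝ) k * y j + (Pi.single l 1 : Fin n → ℝ) j * y k
            + (Pi.single k 1 : Fin n → ℝ) j * y l) / euclLength y ^ 3)
        * (skewRow B s i ⬝ᵥ y) := by
  rw [← pd_pd_pd_euclLength_mul_add_quadratic (skewRow B s i) s (-(1 / 2) * s i)
    (1 / ((n : ℝ) + 1)) hy i j k l, douglasCurvature]
  have hspray := fun {w : Fin n → ℝ} (hw : w ≠ 0) (m : Fin n) =>
    sprayCoeff_of_conformal hF hU hx hB hpos hs hw m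
  have hn : (n : ℝ) + 1 ≠ 0 := by positivity
  have h0 : ∀ w : Fin n → ℝ, w ≠ 0 → sprayCoeff F i x w
      - 1 / ((n : ℝ) + 1) * (∑ m, pd m (fun s => sprayCoeff F m x s) w) * w i =
      euclLength w * (skewRow B s i ⬝ᵥ w) + (-(1 / 2) * s i * euclLength w ^ 2
        + 1 / ((n : ℝ) + 1) * ((s ⬝ᵥ w) * w i)) := fun w hw => by
    have h3 : ∀ m, pd m (fun s => sprayCoeff F m x s) w =
        pd m (fun w => randersSpray B s w m) w := fun m =>
      pd_congr ((eventually_ne_zero hw).mono fun v hv => hspray hv m)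
    simp only [h3]
    rw [sum_pd_randersSpray hB hw, hspray hw, randersSpray_eq]
    field_simp
    ring
  have h1 : ∀ w : Fin n → ℝ, w ≠ 0 → _ := fun w hw =>
    pd_congr (i := l) ((eventually_ne_zero hw).mono h0)
  have h2 : ∀ w : Fin n → ℝ, w ≠ 0 → _ := fun w hw =>
    pd_congr (i := k) ((eventually_ne_zero hw).mono h1)
  exact pd_congr ((eventually_ne_zero hy).mono h2)

theorem isDouglasMetric_iff_of_conformal [Nontrivial (Fin n)]
    (hF : ∀ u ∈ U, ∀ w, F u w = h u * randersNorm B w) (hU : IsOpen U) (hB : B ⬝ᵥ B < 1)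
    (hpos : ∀ u ∈ U, 0 < h u) (hh : ContDiffOn ℝ ∞ h U) {s : (Fin n → ℝ) → Fin n → ℝ}
    (hs : ∀ x ∈ U, ∀ k, HasLineDerivAt ℝ h (h x * s x k) x (Pi.single k 1)) :
    IsDouglasMetric U F ↔ ∀ x ∈ U, ∀ i j, B i * s x j = s x i * B j := by
  refine ⟨fun hD x hx i j => ?_, fun hD =>
    ⟨isFinslerMetric_of_conformal hF hB hpos hh, fun x hx y hy i j k l => ?_⟩⟩
  -- At the unit vector `y = e_m` with `m ≠ j`, the component with all three lower indices equal to
  -- `j` is `3 * skewRow B (s x) i j`.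
  · obtain ⟨m, hm⟩ := exists_ne j
    have hy : (Pi.single m 1 : Fin n → ℝ) ≠ 0 := by simp
    have h1 := hD.2 x hx _ hy i j j j
    rw [douglasCurvature_of_conformal hF hU hx hB (hpos x hx) (hs x hx) hy] at h1
    simp [hm.symm, euclLength, skewRow] at h1
    linarith
  · have h0 : skewRow B (s x) i = 0 := by
      ext m
      simp [skewRow, hD x hx i m]
    rw [douglasCurvature_of_conformal hF hU hx hB (hpos x hx) (hs x hx) hy, h0]
    simp

end Conformal

/-! ### The metrics on `ℝ² ⋊ ℝ⁺` -/

/-- The order `![b, c, a]` reflects that `e₁` points along the last coordinate. -/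
theorem conformal_randers_eq (a b c : ℝ) (f : (Fin 3 → ℝ) → ℝ) {p : Fin 3 → ℝ} (hp : p ∈ G)
    (v : Fin 3 → ℝ) :
    conformal f (randers metric (fieldX a b c)) p v =
      Real.exp (f p) * (p 2)⁻¹ * randersNorm ![b, c, a] v := by
  have hz : 0 < p 2 := hp
  have h1 : √(metric p v v) = (p 2)⁻¹ * euclLength v := by
    rw [metric, Real.sqrt_div' _ (by positivity), Real.sqrt_sq hz.le, euclLength,
      div_eq_inv_mul, vec3_dotProduct]
  have h2 : metric p (fieldX a b c p) v = (p 2)⁻¹ * (![b, c, a] ⬝ᵥ v) := by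
    simp only [vec3_dotProduct]
    simp [metric, fieldX, e₁, e₂, e₃]
    field_simp
  rw [conformal, randers, alpha, beta, h1, h2, randersNorm]
  ring

theorem dotProduct_lt_one_of_norm_fieldX {a b c : ℝ}
    (hX : ∀ p ∈ G, √(metric p (fieldX a b c p) (fieldX a b c p)) < 1) :
    ![b, c, a] ⬝ᵥ ![b, c, a] < 1 := by
  -- The length of a left-invariant field is constant, so the identity element, where `z = 1`,
  -- suffices.
  have h := hX ![0, 0, 1] (by simp [G])
  rw [Real.sqrt_lt' one_pos] at h
  rw [vec3_dotProduct]
  simp [metric, fieldX, e₁, e₂, e₃] at h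
  simp
  linarith

/-- Since `log h = f - log z`, its gradient is that of `f` corrected by `-1/z` in the last slot;
this correction produces the right sides `b` and `c` of the equations. -/
theorem hasLineDerivAt_exp_mul_inv {f : (Fin 3 → ℝ) → ℝ} (hf : ContDiffOn ℝ ∞ f G)
    {p : Fin 3 → ℝ} (hp : p ∈ G) (k : Fin 3) :
    HasLineDerivAt ℝ (fun u => Real.exp (f u) * (u 2)⁻¹)
      (Real.exp (f p) * (p 2)⁻¹ * (pd k f p - (Pi.single k 1 : Fin 3 → ℝ) 2 * (p 2)⁻¹)) p
      (Pi.single k 1) := by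
  have hz : p 2 ≠ 0 := ne_of_gt hp
  have h1 : HasLineDerivAt ℝ f (pd k f p) p (Pi.single k 1) :=
    (((hf.contDiffAt (isOpen_G.mem_nhds hp)).differentiableAt
      (by simp)).lineDifferentiableAt).hasLineDerivAt
  have h2 : HasLineDerivAt ℝ (fun u => Real.exp (f u)) (Real.exp (f p) * pd k f p) p
      (Pi.single k 1) := by
    simpa [HasLineDerivAt] using HasDerivAt.exp h1
  convert hasLineDerivAt_mul h2 (hasLineDerivAt_inv (hasLineDerivAt_apply 2 p _) hz) using 1
  field_simp
  ring

end

end DouglasRanders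

open DouglasRanders in
theorem proposition4p6 (a b c : ℝ)
    (hX : ∀ p ∈ G, √(metric p (fieldX a b c p) (fieldX a b c p)) < 1)
    (f : (Fin 3 → ℝ) → ℝ) (hf : ContDiffOn ℝ ∞ f G) :
    IsDouglasMetric G (conformal f (randers metric (fieldX a b c))) ↔
      ∀ p ∈ G,
        b * p 2 * pd 2 f p - a * p 2 * pd 0 f p = b ∧
        c * p 2 * pd 0 f p - b * p 2 * pd 1 f p = 0 ∧
        c * p 2 * pd 2 f p - a * p 2 * pd 1 f p = c := by
  have hz : ∀ p ∈ G, 0 < p 2 := fun _ hp => hp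
  rw [isDouglasMetric_iff_of_conformal (h := fun u => Real.exp (f u) * (u 2)⁻¹)
    (s := fun p k => pd k f p - (Pi.single k 1 : Fin 3 → ℝ) 2 * (p 2)⁻¹)
    (fun u hu w => conformal_randers_eq a b c f hu w) isOpen_G
    (dotProduct_lt_one_of_norm_fieldX hX)
    (fun u hu => mul_pos (Real.exp_pos _) (inv_pos.2 (hz u hu)))
    (hf.exp.mul (ContDiffOn.inv (by fun_prop) fun u hu => (hz u hu).ne'))
    (fun p hp k => hasLineDerivAt_exp_mul_inv hf hp k)]
  refine forall₂_congr fun p hp => ?_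
  have h0 := (hz p hp).ne'
  constructor
  · intro h
    -- The index pairs `(0, 2)`, `(1, 0)`, `(1, 2)` give the three equations in order.
    have h02 := h 0 2
    have h10 := h 1 0
    have h12 := h 1 2
    simp at h02 h10 h12
    field_simp at h02 h10 h12
    refine ⟨by linarith, ?_, by linarith⟩
    linear_combination p 2 * h10
  · rintro ⟨h1, h2, h3⟩
    have h2' : c * pd 0 f p = b * pd 1 f p := by
      refine mul_left_cancel₀ h0 ?_
      linear_combination h2
    intro i j
    fin_cases i <;> fin_cases j <;> simp <;> field_simp <;> linarith
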